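/- Let $V$ be the complex vector space of quadratic forms in $\mathbb{C}[x,y,z]$. There is a nonempty Zariski-open subset $U\subseteq V^4$ such that, for every $(f_1,f_2,f_3,f_4)\in U$ and every integer $k\ge 1$, the Hilbert series of the graded algebra $R=\mathbb{C}[x,y,z]/(f_1,f_2,f_3,f_4)^k$ is $$\sum_{i\ge 0}\dim_{\mathbb{C}}(R_i)\,t^i=\sum_{i=0}^{2k-1}\binom{i+2}{2}t^i+(3k-1)\,t^{2k}.$$ -/

import Mathlib

/-- Tuples of `r` forms of degree `d` in `n` variables over `ℂ`. -/
abbrev FormTuple (n d r : ℕ) : Type :=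
  Fin r → MvPolynomial.homogeneousSubmodule (Fin n) ℂ d

/-- A set of `r`-tuples of forms is Zariski open if it is the non-vanishing locus of a family of
polynomials in the coefficients of the forms. The variable `(j, m)` stands for the coefficient of
the monomial with exponent `m` in the `j`-th form; it takes the value zero when `m` does not have
degree `d`. -/
def IsZariskiOpen {n d r : ℕ} (U : Set (FormTuple n d r)) : Prop :=
  ∃ S : Set (MvPolynomial (Fin r × (Fin n →₀ ℕ)) ℂ),
    U = {f | ∃ P ∈ S,
      MvPolynomial.eval (fun p => MvPolynomial.coeff p.2 (f p.1 : MvPolynomial (Fin n) ℂ)) P ≠ 0}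

/-- The degree `i` component of `ℂ[x₁, …, xₙ] / J`: the classes of the forms of degree `i`. -/
noncomputable def quotientComponent {n : ℕ} (J : Ideal (MvPolynomial (Fin n) ℂ)) (i : ℕ) :
    Submodule ℂ (MvPolynomial (Fin n) ℂ ⧸ J) :=
  (MvPolynomial.homogeneousSubmodule (Fin n) ℂ i).map (Ideal.Quotient.mkₐ ℂ J).toLinearMap

/-- The Hilbert series of `ℂ[x₁, …, xₙ] / J`, for a homogeneous ideal `J`. -/
noncomputable def hilbertSeries {n : ℕ} (J : Ideal (MvPolynomial (Fin n) ℂ)) : PowerSeries ℤ :=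
  PowerSeries.mk fun i => (Module.finrank ℂ (quotientComponent J i) : ℤ)

open MvPolynomial

/-! ### Dimension bounds for powers of a finite-dimensional subspace of an algebra -/

section FinrankPow

variable {K R : Type*} [Field K] [CommRing R] [Algebra K R]

/-! Let `S_i` be the ternary forms of degree `i`, `V = ⟨a, b⟩`, `M = ⟨a, b, c⟩` and `W = ⟨a, b, c,
d⟩` for four general quadrics. The ideal `(a, b, c, d)^k` is generated by `W^k ⊆ S_{2k}`, so the
quotient is all of `S_i` for `i < 2k`. It vanishes for `i > 2k` because `S_3 = W S_1` gives
`S_{2k+1} = W^k S_1`. What remains is `dim W^k = 2k² + 2`, that is, codimension `3k - 1` in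
`S_{2k}`.

Upper bound (`finrank_pow_le`): geometrically, the four quadrics map the plane to a quartic surface.
Algebraically, `S_4 = M S_2` and `S_2 = W + ⟨u, v⟩` make the `ℂ[a, b, c]`-module generated by `1, d,
u, v` stable under `d`, so `d` satisfies a monic quartic equation (`pow_four_mem_of_mul_mem`). Only
the powers of `d` up to the third are then needed in `W^k`.

Lower bound (`finrank_even_le`): for `k ≥ 2`, `S_{2k}` lies in `W^k + V^{k-1} u + V^{k-1} v +
V^{k-2} g`, and the last three terms have total dimension at most `k + k + (k - 1)`.

All `k` are thus governed by the finitely many conditions in `SpanConditions`. Each says that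
elements depending polynomially on the quadrics span some `S_i`, an open condition given by a
determinant (`exists_eval_ne_zero_of_le_span`). One explicit quadruple satisfies them all, so they
hold on a nonempty open set. -/

theorem mul_span_singleton_eq_map (M : Submodule K R) (a : R) :
    M * Submodule.span K {a} = M.map (LinearMap.mulRight K a) := by
  ext x
  simp [Submodule.mem_mul_span_singleton]

theorem finrank_mul_span_singleton_le (M : Submodule K R) (hM : M.FG) (a : R) :
    Module.finrank K ↥(M * Submodule.span K {a}) ≤ Module.finrank K M := by
  have : Module.Finite K M := Module.Finite.iff_fg.2 hM
  rw [mul_span_singleton_eq_map]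
  exact Submodule.finrank_map_le _ _

theorem finrank_sup_le (M N : Submodule K R) (hM : M.FG) (hN : N.FG) :
    Module.finrank K ↥(M ⊔ N) ≤ Module.finrank K M + Module.finrank K N := by
  have : Module.Finite K M := Module.Finite.iff_fg.2 hM
  have : Module.Finite K N := Module.Finite.iff_fg.2 hN
  exact Submodule.finrank_add_le_finrank_add_finrank M N

theorem finrank_span_singleton_le (a : R) :
    Module.finrank K ↥(Submodule.span K {a}) ≤ 1 := by
  simpa using finrank_span_le_card (R := K) ({a} : Set R)

/-- A product of `n + 1` factors either avoids `N` or has a factor in `N` that can be split off. For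
`N` a line this yields a Pascal-type recursion for dimensions. -/
theorem sup_pow_succ_eq (M N : Submodule K R) (n : ℕ) :
    (M ⊔ N) ^ (n + 1) = M ^ (n + 1) ⊔ (M ⊔ N) ^ n * N := by
  induction n with
  | zero => simp
  | succ n ih =>
    apply le_antisymm
    · rw [pow_succ, Submodule.mul_sup]
      refine sup_le ?_ le_sup_right
      conv_lhs => rw [ih]
      rw [Submodule.sup_mul, ← pow_succ]
      refine sup_le_sup le_rfl ?_
      rw [mul_assoc, mul_comm N M, ← mul_assoc]
      refine mul_le_mul_left ?_ _
      rw [pow_succ (M ⊔ N) n]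
      exact mul_le_mul_right le_sup_left _
    · refine sup_le (pow_le_pow_left' le_sup_left _) ?_
      rw [pow_succ (M ⊔ N) (n + 1)]
      exact mul_le_mul_right le_sup_right _

theorem finrank_sup_span_singleton_pow_succ_le (M : Submodule K R) (hM : M.FG) (a : R) (n : ℕ) :
    Module.finrank K ↥((M ⊔ Submodule.span K {a}) ^ (n + 1)) ≤
      Module.finrank K ↥(M ^ (n + 1)) +
        Module.finrank K ↥((M ⊔ Submodule.span K {a}) ^ n) := by
  have ha : (Submodule.span K {a}).FG := Submodule.fg_span_singleton a
  rw [sup_pow_succ_eq]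
  refine (finrank_sup_le _ _ (hM.pow _) (((hM.sup ha).pow _).mul ha)).trans ?_
  exact Nat.add_le_add_left (finrank_mul_span_singleton_le _ ((hM.sup ha).pow _) a) _

theorem finrank_pow_zero_le (M : Submodule K R) : Module.finrank K ↥(M ^ 0) ≤ 1 := by
  rw [pow_zero, Submodule.one_eq_span]
  exact finrank_span_singleton_le 1

theorem finrank_span_singleton_pow_le (a : R) (n : ℕ) :
    Module.finrank K ↥(Submodule.span K {a} ^ n) ≤ 1 := by
  rw [Submodule.span_pow, Set.singleton_pow]
  exact finrank_span_singleton_le _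

theorem finrank_span_two_pow_le (a b : R) (n : ℕ) :
    Module.finrank K ↥((Submodule.span K {a} ⊔ Submodule.span K {b}) ^ n) ≤ n + 1 := by
  induction n with
  | zero => exact finrank_pow_zero_le _
  | succ n ih =>
    have h := finrank_sup_span_singleton_pow_succ_le (K := K) (Submodule.span K {a})
      (Submodule.fg_span_singleton a) b n
    have := finrank_span_singleton_pow_le (K := K) a (n + 1)
    omega

theorem finrank_span_three_pow_le (a b c : R) (n : ℕ) :
    Module.finrank K ↥((Submodule.span K {a} ⊔ Submodule.span K {b} ⊔ Submodule.span K {c}) ^ n) ≤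
      (n + 2).choose 2 := by
  induction n with
  | zero => exact finrank_pow_zero_le _
  | succ n ih =>
    have h := finrank_sup_span_singleton_pow_succ_le (K := K)
      (Submodule.span K {a} ⊔ Submodule.span K {b})
      ((Submodule.fg_span_singleton a).sup (Submodule.fg_span_singleton b)) c n
    have := finrank_span_two_pow_le (K := K) a b (n + 1)
    have : (n + 1 + 2).choose 2 = (n + 2) + (n + 2).choose 2 := by
      rw [show n + 1 + 2 = (n + 2) + 1 from rfl, Nat.choose_succ_succ' (n + 2) 1,
        Nat.choose_one_right]
    omega

/-- If `d` acts on `M d + M u + M v + M ^ 2` with coefficients in `M`, it satisfies a monic equation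
of degree four whose coefficients lie in the powers of `M`. -/
theorem pow_four_mem_of_mul_mem {M : Submodule K R} {d u v : R}
    (h : ∀ w ∈ ({d, u, v} : Set R), d * w ∈ M * (M ⊔ Submodule.span K {d} ⊔
      Submodule.span K {u} ⊔ Submodule.span K {v})) :
    d ^ 4 ∈ M ^ 4 ⊔ M ^ 3 * Submodule.span K {d} ⊔ M ^ 2 * Submodule.span K {d} ^ 2 ⊔
      M * Submodule.span K {d} ^ 3 := by
  have key : ∀ w ∈ ({d, u, v} : Set R), ∃ p ∈ M ^ 2, ∃ q ∈ M, ∃ r ∈ M, ∃ s ∈ M,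
      d * w = p + q * d + r * u + s * v := by
    intro w hw
    have := h w hw
    simp only [Submodule.mul_sup] at this
    obtain ⟨y, hy, z, hz, h1⟩ := Submodule.mem_sup.1 this
    obtain ⟨y', hy', z', hz', rfl⟩ := Submodule.mem_sup.1 hy
    obtain ⟨y'', hy'', z'', hz'', rfl⟩ := Submodule.mem_sup.1 hy'
    obtain ⟨s, hs, rfl⟩ := Submodule.mem_mul_span_singleton.1 hz
    obtain ⟨r, hr, rfl⟩ := Submodule.mem_mul_span_singleton.1 hz'
    obtain ⟨q, hq, rfl⟩ := Submodule.mem_mul_span_singleton.1 hz''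
    exact ⟨y'', by rwa [pow_two], q, hq, r, hr, s, hs, h1.symm⟩
  obtain ⟨p, hp, q, hq, β, hβ, γ, hγ, e1⟩ := key d (by simp)
  obtain ⟨p', hp', q', hq', α₁, hα₁, α₂, hα₂, e2⟩ := key u (by simp)
  obtain ⟨p'', hp'', q'', hq'', δ₁, hδ₁, δ₂, hδ₂, e3⟩ := key v (by simp)
  -- Cramer's rule on the equations `e2`, `e3` for `u`, `v`, whose determinant is `(d - α₁) * (d -
  -- δ₂) - α₂ * δ₁`, eliminates both from `e1`. The result is sorted by powers of `d`.
  have e : d ^ 4 =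
      ((α₁ * δ₂ - α₂ * δ₁) * p + β * (α₂ * p'' - δ₂ * p') + γ * (δ₁ * p' - α₁ * p'')) +
      ((α₁ * δ₂ - α₂ * δ₁) * q - (α₁ + δ₂) * p + β * (p' - δ₂ * q' + α₂ * q'') +
        γ * (p'' - α₁ * q'' + δ₁ * q')) * d +
      (p - (α₁ + δ₂) * q - (α₁ * δ₂ - α₂ * δ₁) + β * q' + γ * q'') * d ^ 2 +
      (q + (α₁ + δ₂)) * d ^ 3 := by
    have hD : ((d - α₁) * (d - δ₂) - α₂ * δ₁) * (d * d - p - q * d) =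
        β * ((p' + q' * d) * (d - δ₂) + α₂ * (p'' + q'' * d)) +
          γ * ((p'' + q'' * d) * (d - α₁) + δ₁ * (p' + q' * d)) := by
      linear_combination ((d - α₁) * (d - δ₂) - α₂ * δ₁) * e1 +
        (β * (d - δ₂) + γ * δ₁) * e2 + (β * α₂ + γ * (d - α₁)) * e3
    linear_combination hD
  have m2 : ∀ {a b : R}, a ∈ M → b ∈ M → a * b ∈ M ^ 2 := fun ha hb => by
    rw [pow_two]; exact Submodule.mul_mem_mul ha hb
  have m3 : ∀ {a b : R}, a ∈ M → b ∈ M ^ 2 → a * b ∈ M ^ 3 := fun ha hb => by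
    rw [pow_succ']; exact Submodule.mul_mem_mul ha hb
  have m4 : ∀ {a b : R}, a ∈ M ^ 2 → b ∈ M ^ 2 → a * b ∈ M ^ 4 := fun ha hb => by
    rw [show 4 = 2 + 2 from rfl, pow_add]; exact Submodule.mul_mem_mul ha hb
  have m4' : ∀ {a b : R}, a ∈ M → b ∈ M ^ 3 → a * b ∈ M ^ 4 := fun ha hb => by
    rw [pow_succ']; exact Submodule.mul_mem_mul ha hb
  have m3' : ∀ {a b : R}, a ∈ M ^ 2 → b ∈ M → a * b ∈ M ^ 3 := fun ha hb => by
    rw [pow_succ]; exact Submodule.mul_mem_mul ha hb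
  have hd : d ∈ Submodule.span K {d} := Submodule.mem_span_singleton_self d
  have hΔ : α₁ * δ₂ - α₂ * δ₁ ∈ M ^ 2 := sub_mem (m2 hα₁ hδ₂) (m2 hα₂ hδ₁)
  have hτ : α₁ + δ₂ ∈ M := add_mem hα₁ hδ₂
  rw [e]
  refine Submodule.add_mem_sup (Submodule.add_mem_sup (Submodule.add_mem_sup ?_
    (Submodule.mul_mem_mul ?_ hd)) (Submodule.mul_mem_mul ?_ (Submodule.pow_mem_pow _ hd 2)))
    (Submodule.mul_mem_mul ?_ (Submodule.pow_mem_pow _ hd 3))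
  · exact add_mem (add_mem (m4 hΔ hp) (m4' hβ (sub_mem (m3 hα₂ hp'') (m3 hδ₂ hp'))))
      (m4' hγ (sub_mem (m3 hδ₁ hp') (m3 hα₁ hp'')))
  · exact add_mem (add_mem (sub_mem (m3' hΔ hq) (m3 hτ hp))
      (m3 hβ (add_mem (sub_mem hp' (m2 hδ₂ hq')) (m2 hα₂ hq''))))
      (m3 hγ (add_mem (sub_mem hp'' (m2 hα₁ hq'')) (m2 hδ₁ hq')))
  · exact add_mem (add_mem (sub_mem (sub_mem hp (m2 hτ hq)) hΔ) (m2 hβ hq')) (m2 hγ hq'')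
  · exact add_mem hq hτ

/-- The relation rewrites any fourth power of `N` through lower ones, with total degree preserved,
so exponents of `N` above three never survive. -/
theorem sup_pow_add_three_le {M N : Submodule K R}
    (h : N ^ 4 ≤ M ^ 4 ⊔ M ^ 3 * N ⊔ M ^ 2 * N ^ 2 ⊔ M * N ^ 3) (n : ℕ) :
    (M ⊔ N) ^ (n + 3) ≤
      M ^ (n + 3) ⊔ M ^ (n + 2) * N ⊔ M ^ (n + 1) * N ^ 2 ⊔ M ^ n * N ^ 3 := by
  -- Submodules form an idempotent commutative semiring: written with `+`, the expansions are found
  -- by `ring`, and `hadd` removes the multiplicities.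
  simp only [← Submodule.add_eq_sup] at *
  have hadd : ∀ A : Submodule K R, A + A = A := fun A => by simp
  induction n with
  | zero =>
    have : (M + N) ^ 3 = M ^ 3 + (M ^ 2 * N + M ^ 2 * N + M ^ 2 * N) +
      (M * N ^ 2 + M * N ^ 2 + M * N ^ 2) + N ^ 3 := by ring
    rw [this, hadd, hadd, hadd, hadd]
    simp
  | succ n ih =>
    rw [show n + 1 + 3 = (n + 3) + 1 from rfl, pow_succ (M + N)]
    refine (mul_le_mul_left ih _).trans ?_
    have h4 : M ^ n * N ^ 4 ≤ M ^ (n + 4) + M ^ (n + 3) * N + M ^ (n + 2) * N ^ 2 +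
        M ^ (n + 1) * N ^ 3 := by
      refine (mul_le_mul_right h _).trans (le_of_eq ?_)
      ring
    have e : (M ^ (n + 3) + M ^ (n + 2) * N + M ^ (n + 1) * N ^ 2 + M ^ n * N ^ 3) * (M + N) =
        M ^ (n + 4) + (M ^ (n + 3) * N + M ^ (n + 3) * N) +
        (M ^ (n + 2) * N ^ 2 + M ^ (n + 2) * N ^ 2) +
        (M ^ (n + 1) * N ^ 3 + M ^ (n + 1) * N ^ 3) + M ^ n * N ^ 4 := by ring
    rw [e, hadd, hadd, hadd]
    simp only [Submodule.add_eq_sup] at *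
    exact sup_le le_rfl h4

theorem finrank_mul_span_singleton_pow_le (M : Submodule K R) (hM : M.FG) (a : R) (n : ℕ) :
    Module.finrank K ↥(M * Submodule.span K {a} ^ n) ≤ Module.finrank K M := by
  rw [Submodule.span_pow, Set.singleton_pow]
  exact finrank_mul_span_singleton_le M hM _

theorem two_mul_choose_two (n : ℕ) : 2 * (n + 1).choose 2 = (n + 1) * n := by
  rw [Nat.choose_two_right, Nat.mul_div_cancel' (Nat.even_mul_pred_self _).two_dvd]
  simp

/-- The four summands `M^(m-i) d^i`, `i ≤ 3`, have dimension at most `(m - i + 2).choose 2`, and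
these binomials add up to `2m² + 2`. -/
theorem finrank_span_four_pow_le {a b c d : R}
    (h : d ^ 4 ∈ (Submodule.span K {a} ⊔ Submodule.span K {b} ⊔ Submodule.span K {c}) ^ 4 ⊔
      (Submodule.span K {a} ⊔ Submodule.span K {b} ⊔ Submodule.span K {c}) ^ 3 *
        Submodule.span K {d} ⊔
      (Submodule.span K {a} ⊔ Submodule.span K {b} ⊔ Submodule.span K {c}) ^ 2 *
        Submodule.span K {d} ^ 2 ⊔
      (Submodule.span K {a} ⊔ Submodule.span K {b} ⊔ Submodule.span K {c}) *
        Submodule.span K {d} ^ 3) (k : ℕ) :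
    Module.finrank K ↥((Submodule.span K {a} ⊔ Submodule.span K {b} ⊔ Submodule.span K {c} ⊔
      Submodule.span K {d}) ^ (k + 1)) ≤ 2 * (k + 1) ^ 2 + 2 := by
  have hM := finrank_span_three_pow_le (K := K) a b c
  have hfg : (Submodule.span K {a} ⊔ Submodule.span K {b} ⊔ Submodule.span K {c}).FG :=
    ((Submodule.fg_span_singleton a).sup (Submodule.fg_span_singleton b)).sup
      (Submodule.fg_span_singleton c)
  set M := Submodule.span K {a} ⊔ Submodule.span K {b} ⊔ Submodule.span K {c}
  have hd : (Submodule.span K {d}).FG := Submodule.fg_span_singleton d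
  have hstep := finrank_sup_span_singleton_pow_succ_le M hfg d
  have h0 : Module.finrank K ↥((M ⊔ Submodule.span K {d}) ^ 0) ≤ 1 :=
    finrank_pow_zero_le _
  have h1 := hstep 0
  have h2 := hstep 1
  have c1 := hM 1
  have c2 := hM 2
  simp only [zero_add, Nat.reduceAdd, Nat.choose] at c1 c2 h1 h2
  -- The reduction needs exponent at least three. Exponents one and two follow from the recursion,
  -- with bounds `3 + 1` and `6 + 4`.
  match k with
  | 0 => simp only [zero_add, Nat.reduceAdd]; omega
  | 1 => simp only [Nat.reduceAdd, one_add_one_eq_two]; omega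
  | n + 2 =>
    have hle := sup_pow_add_three_le (M := M) (N := Submodule.span K {d}) (by
      rw [Submodule.span_pow {d} 4, Set.singleton_pow]
      exact (Submodule.span_singleton_le_iff_mem _ _).2 h) n
    have f1 : (M ^ (n + 3) ⊔ M ^ (n + 2) * Submodule.span K {d} ⊔
        M ^ (n + 1) * Submodule.span K {d} ^ 2).FG :=
      ((hfg.pow _).sup ((hfg.pow _).mul hd)).sup ((hfg.pow _).mul (hd.pow _))
    have := Module.Finite.iff_fg.2 (f1.sup ((hfg.pow n).mul (hd.pow 3)))
    have i1 := Submodule.finrank_mono hle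
    have i2 := finrank_sup_le _ _ f1 ((hfg.pow n).mul (hd.pow 3))
    have i3 := finrank_sup_le _ _ ((hfg.pow (n + 3)).sup ((hfg.pow (n + 2)).mul hd))
      ((hfg.pow (n + 1)).mul (hd.pow 2))
    have i4 := finrank_sup_le _ _ (hfg.pow (n + 3)) ((hfg.pow (n + 2)).mul hd)
    have j1 := finrank_mul_span_singleton_le _ (hfg.pow (n + 2)) d
    have j2 := finrank_mul_span_singleton_pow_le _ (hfg.pow (n + 1)) d 2
    have j3 := finrank_mul_span_singleton_pow_le _ (hfg.pow n) d 3
    have k0 := hM n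
    have k1 := hM (n + 1)
    have k2 := hM (n + 2)
    have k3 := hM (n + 3)
    have l0 := two_mul_choose_two (n + 1)
    have l1 := two_mul_choose_two (n + 2)
    have l2 := two_mul_choose_two (n + 3)
    have l3 := two_mul_choose_two (n + 4)
    simp only [show n + 2 + 1 = n + 3 from rfl, show n + 1 + 1 = n + 2 from rfl,
      show n + 3 + 1 = n + 4 from rfl, show n + 4 + 1 = n + 5 from rfl] at *
    nlinarith

end FinrankPow

/-! ### Spaces of ternary forms -/

section Forms

/-- The forms of degree `d` in three variables. -/
abbrev ternaryForms (d : ℕ) : Submodule ℂ (MvPolynomial (Fin 3) ℂ) :=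
  homogeneousSubmodule (Fin 3) ℂ d

theorem homogeneousSubmodule_eq_restrictSupport (σ K : Type*) [CommSemiring K] (d : ℕ) :
    homogeneousSubmodule σ K d = restrictSupport K {m | m.degree = d} :=
  homogeneousSubmodule_eq_finsupp_supported σ K d

theorem finrank_homogeneousSubmodule (n d : ℕ) (K : Type*) [Field K] :
    Module.finrank K (homogeneousSubmodule (Fin n) K d) = (n + d - 1).choose d := by
  rw [homogeneousSubmodule_eq_restrictSupport,
    Module.finrank_eq_nat_card_basis (basisRestrictSupport K {m : Fin n →₀ ℕ | m.degree = d})]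
  have : {m : Fin n →₀ ℕ | m.degree = d} =
      ↑(Finset.univ.finsuppAntidiag d : Finset (Fin n →₀ ℕ)) := by
    ext m
    simp [Finset.mem_finsuppAntidiag, Finsupp.degree_eq_sum]
  rw [this, Nat.card_coe_set_eq, Set.ncard_coe_finset, Finset.card_finsuppAntidiag_nat_eq_choose]
  simp

theorem finrank_ternaryForms (d : ℕ) : Module.finrank ℂ (ternaryForms d) = (d + 2).choose 2 := by
  rw [finrank_homogeneousSubmodule, show 3 + d - 1 = d + 2 by omega, Nat.choose_symm_add]

theorem ternaryForms_add (m n : ℕ) :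
    ternaryForms (m + n) = ternaryForms m * ternaryForms n := by
  have h := homogeneousSubmodule_one_pow (σ := Fin 3) (R := ℂ)
  rw [ternaryForms, ternaryForms, ternaryForms, ← h (m + n), ← h m, ← h n, pow_add]

end Forms

/-! ### Spanning is an open condition -/

section Openness

variable {σ τ ι K : Type*} [Field K]

/-- If the specialization at `c₀` of a family of generic forms of degree `d` spans the space of
forms of degree `d`, then so does the specialization at the points of a principal open set. -/
theorem exists_eval_ne_zero_of_le_span [Finite σ] {d : ℕ}
    (v : ι → MvPolynomial σ (MvPolynomial τ K)) (hv : ∀ i, (v i).IsHomogeneous d) (c₀ : τ → K)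
    (h₀ : homogeneousSubmodule σ K d ≤
      Submodule.span K (Set.range fun i => map (eval c₀) (v i))) :
    ∃ P : MvPolynomial τ K, eval c₀ P ≠ 0 ∧ ∀ c : τ → K, eval c P ≠ 0 →
      homogeneousSubmodule σ K d ≤
        Submodule.span K (Set.range fun i => map (eval c) (v i)) := by
  classical
  have hfin : Set.Finite {m : σ →₀ ℕ | m.degree = d} := Finsupp.finite_of_degree_eq d
  let T := {m : σ →₀ ℕ | m.degree = d}
  let b : Module.Basis T K (homogeneousSubmodule σ K d) :=
    (basisRestrictSupport K T).map
      (LinearEquiv.ofEq _ _ (homogeneousSubmodule_eq_restrictSupport σ K d).symm)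
  have : Fintype T := hfin.fintype
  let w : (τ → K) → ι → homogeneousSubmodule σ K d := fun c i =>
    ⟨map (eval c) (v i), (hv i).map _⟩
  have hspan : ∀ (κ : Type _) (e : κ → ι) (c : τ → K),
      Submodule.span K (Set.range fun i => w c (e i)) = ⊤ →
      homogeneousSubmodule σ K d ≤ Submodule.span K (Set.range fun i => map (eval c) (v i)) := by
    intro κ e c h p hp
    have h1 : (⟨p, hp⟩ : homogeneousSubmodule σ K d) ∈
        Submodule.span K (Set.range fun i => w c (e i)) := h ▸ Submodule.mem_top
    have h2 := Submodule.mem_map_of_mem (f := (homogeneousSubmodule σ K d).subtype) h1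
    rw [Submodule.map_span] at h2
    refine Submodule.span_mono ?_ h2
    rintro _ ⟨_, ⟨i, rfl⟩, rfl⟩
    exact ⟨e i, rfl⟩
  have htop : ⊤ ≤ Submodule.span K (Set.range (w c₀)) := by
    rintro ⟨p, hp⟩ -
    have := h₀ hp
    have hr : (Set.range fun i => map (eval c₀) (v i)) =
        (homogeneousSubmodule σ K d).subtype '' Set.range (w c₀) := by
      rw [← Set.range_comp]; rfl
    rw [hr, ← Submodule.map_span] at this
    obtain ⟨q, hq, rfl⟩ := this
    exact hq
  -- A basis is extracted from the spanning family at `c₀`. Its indices stay fixed as `c` varies, so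
  -- the determinant of its coefficients in the monomial basis is a polynomial in `c`, nonzero at
  -- `c₀`.
  obtain ⟨s, hs, hs1, hs2⟩ := exists_linearIndependent K (Set.range (w c₀))
  have hb' := Module.Basis.mk hs2 (by
    rw [Subtype.range_coe, hs1]; exact htop)
  have hequiv : Nonempty (T ≃ s) := ⟨b.indexEquiv hb'⟩
  obtain ⟨E⟩ := hequiv
  choose e he using fun t : T => hs (E t).2
  let A : Matrix T T (MvPolynomial τ K) := fun m t => coeff m.1 (v (e t))
  have hA : ∀ c, eval c A.det = b.det (fun t => w c (e t)) := by
    intro c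
    rw [RingHom.map_det, Module.Basis.det_apply]
    congr 1
  refine ⟨A.det, ?_, fun c hc => ?_⟩
  · rw [hA, ← isUnit_iff_ne_zero, ← Module.Basis.is_basis_iff_det]
    have hwe : (fun t => w c₀ (e t)) = (fun x : s => (x : homogeneousSubmodule σ K d)) ∘ E :=
      funext fun t => he t
    rw [hwe]
    refine ⟨hs2.comp _ E.injective, ?_⟩
    rw [Set.range_comp, E.range_eq_univ, Set.image_univ, Subtype.range_coe, hs1]
    exact top_le_iff.1 htop
  · rw [hA, ← isUnit_iff_ne_zero, ← Module.Basis.is_basis_iff_det] at hc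
    exact hspan T e c hc.2

end Openness

/-! ### Dimension of the powers of the span of four general quadrics -/

section GeneralQuadrics

/-- Spanning conditions on four ternary quadrics `a, b, c, d`, relative to auxiliary quadrics `u, v`
and an auxiliary quartic `g`. They hold for general quadrics, and they determine the Hilbert
function of every power of the ideal `(a, b, c, d)`. -/
structure SpanConditions (a b c d u v g : MvPolynomial (Fin 3) ℂ) : Prop where
  isQuadric : (ℂ ∙ a) ⊔ (ℂ ∙ b) ⊔ (ℂ ∙ c) ⊔ (ℂ ∙ d) ≤ ternaryForms 2
  two : ternaryForms 2 ≤ (ℂ ∙ a) ⊔ (ℂ ∙ b) ⊔ (ℂ ∙ c) ⊔ (ℂ ∙ d) ⊔ (ℂ ∙ u) ⊔ (ℂ ∙ v)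
  three : ternaryForms 3 ≤ ((ℂ ∙ a) ⊔ (ℂ ∙ b) ⊔ (ℂ ∙ c) ⊔ (ℂ ∙ d)) * ternaryForms 1
  four : ternaryForms 4 ≤ ((ℂ ∙ a) ⊔ (ℂ ∙ b) ⊔ (ℂ ∙ c)) * ternaryForms 2
  four' : ternaryForms 4 ≤ ((ℂ ∙ a) ⊔ (ℂ ∙ b) ⊔ (ℂ ∙ c) ⊔ (ℂ ∙ d)) ^ 2 ⊔
    ((ℂ ∙ a) ⊔ (ℂ ∙ b)) * ternaryForms 2 ⊔ (ℂ ∙ g)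
  six : ternaryForms 6 ≤ ((ℂ ∙ a) ⊔ (ℂ ∙ b) ⊔ (ℂ ∙ c) ⊔ (ℂ ∙ d)) ^ 3 ⊔
    ((ℂ ∙ a) ⊔ (ℂ ∙ b)) * ternaryForms 4

variable {a b c d u v g : MvPolynomial (Fin 3) ℂ}

namespace SpanConditions

theorem odd_le (h : SpanConditions a b c d u v g) (k : ℕ) :
    ternaryForms (2 * k + 1) ≤
      ((ℂ ∙ a) ⊔ (ℂ ∙ b) ⊔ (ℂ ∙ c) ⊔ (ℂ ∙ d)) ^ k * ternaryForms 1 := by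
  induction k with
  | zero => simp
  | succ k ih =>
    rw [show 2 * (k + 1) + 1 = (2 * k + 1) + 2 by ring, ternaryForms_add, pow_succ, mul_assoc]
    refine (mul_le_mul_left ih _).trans ?_
    rw [mul_assoc, ← ternaryForms_add]
    exact mul_le_mul_right h.three _

/-- Condition `four` allows a factor `a`, `b` or `c` to be split off. Only `c` needs care: it
carries `W^(k+3)` into `W^(k+4)`, and in the other term it is absorbed into the forms. -/
theorem even_le_step (h : SpanConditions a b c d u v g) (k : ℕ) :
    ternaryForms (2 * (k + 3)) ≤ ((ℂ ∙ a) ⊔ (ℂ ∙ b) ⊔ (ℂ ∙ c) ⊔ (ℂ ∙ d)) ^ (k + 3) ⊔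
      ((ℂ ∙ a) ⊔ (ℂ ∙ b)) * ternaryForms (2 * (k + 2)) := by
  induction k with
  | zero => exact h.six
  | succ k ih =>
    have h1 : ternaryForms (2 * (k + 1 + 3)) ≤
        ((ℂ ∙ a) ⊔ (ℂ ∙ b) ⊔ (ℂ ∙ c)) * ternaryForms (2 * (k + 3)) := by
      rw [show 2 * (k + 1 + 3) = 4 + 2 * (k + 2) by ring, ternaryForms_add,
        show 2 * (k + 3) = 2 + 2 * (k + 2) by ring, ternaryForms_add, ← mul_assoc]
      exact mul_le_mul_left h.four _
    refine h1.trans ?_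
    rw [Submodule.sup_mul]
    refine sup_le le_sup_right ?_
    refine (mul_le_mul_right ih _).trans ?_
    rw [Submodule.mul_sup]
    refine sup_le_sup ?_ ?_
    · rw [pow_succ' _ (k + 3)]
      exact mul_le_mul_left (le_sup_right.trans le_sup_left) _
    · rw [mul_left_comm]
      refine mul_le_mul_right ?_ _
      rw [show 2 * (k + 1 + 2) = 2 + 2 * (k + 2) by ring, ternaryForms_add 2]
      exact mul_le_mul_left ((le_sup_right.trans le_sup_left).trans h.isQuadric) _

/-- Iterating `even_le_step` costs one factor from `⟨a, b⟩` per step, down to degree four, where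
`four'` and `two` leave only `u`, `v` and `g` outside the powers of the span. -/
theorem even_le (h : SpanConditions a b c d u v g) (k : ℕ) :
    ternaryForms (2 * (k + 2)) ≤ ((ℂ ∙ a) ⊔ (ℂ ∙ b) ⊔ (ℂ ∙ c) ⊔ (ℂ ∙ d)) ^ (k + 2) ⊔
      ((ℂ ∙ a) ⊔ (ℂ ∙ b)) ^ (k + 1) * (ℂ ∙ u) ⊔ ((ℂ ∙ a) ⊔ (ℂ ∙ b)) ^ (k + 1) * (ℂ ∙ v) ⊔
      ((ℂ ∙ a) ⊔ (ℂ ∙ b)) ^ k * (ℂ ∙ g) := by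
  have hle : (ℂ ∙ a) ⊔ (ℂ ∙ b) ≤ (ℂ ∙ a) ⊔ (ℂ ∙ b) ⊔ (ℂ ∙ c) ⊔ (ℂ ∙ d) :=
    le_sup_left.trans le_sup_left
  have h2 := h.two
  have h4 := h.four'
  have hs := h.even_le_step
  set W := (ℂ ∙ a) ⊔ (ℂ ∙ b) ⊔ (ℂ ∙ c) ⊔ (ℂ ∙ d)
  set V := (ℂ ∙ a) ⊔ (ℂ ∙ b)
  induction k with
  | zero =>
    refine h4.trans ?_
    simp only [zero_add, pow_one, pow_zero, one_mul]
    refine sup_le_sup_right (sup_le (le_sup_left.trans le_sup_left) ?_) _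
    refine (mul_le_mul_right h2 _).trans ?_
    rw [Submodule.mul_sup, Submodule.mul_sup, pow_two]
    exact sup_le_sup_right (sup_le_sup_right (mul_le_mul_left hle _) _) _
  | succ k ih =>
    refine (hs k).trans (sup_le (le_sup_left.trans (le_sup_left.trans le_sup_left)) ?_)
    refine (mul_le_mul_right ih _).trans ?_
    simp only [Submodule.mul_sup, ← mul_assoc, ← pow_succ']
    refine sup_le_sup_right (sup_le_sup_right (sup_le_sup_right ?_ _) _) _
    rw [pow_succ' W (k + 2)]
    exact mul_le_mul_left hle _

theorem finrank_even_le (h : SpanConditions a b c d u v g) (k : ℕ) :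
    Module.finrank ℂ (ternaryForms (2 * (k + 1))) ≤
      Module.finrank ℂ ↥(((ℂ ∙ a) ⊔ (ℂ ∙ b) ⊔ (ℂ ∙ c) ⊔ (ℂ ∙ d)) ^ (k + 1)) + (3 * k + 2) := by
  have hV : ((ℂ ∙ a) ⊔ (ℂ ∙ b)).FG :=
    (Submodule.fg_span_singleton a).sup (Submodule.fg_span_singleton b)
  have hW : ((ℂ ∙ a) ⊔ (ℂ ∙ b) ⊔ (ℂ ∙ c) ⊔ (ℂ ∙ d)).FG :=
    (hV.sup (Submodule.fg_span_singleton c)).sup (Submodule.fg_span_singleton d)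
  have hVn := finrank_span_two_pow_le (K := ℂ) a b
  have h2 := h.two
  have he := h.even_le
  set W := (ℂ ∙ a) ⊔ (ℂ ∙ b) ⊔ (ℂ ∙ c) ⊔ (ℂ ∙ d)
  set V := (ℂ ∙ a) ⊔ (ℂ ∙ b)
  have hu : (ℂ ∙ u).FG := Submodule.fg_span_singleton u
  have hv : (ℂ ∙ v).FG := Submodule.fg_span_singleton v
  have hg : (ℂ ∙ g).FG := Submodule.fg_span_singleton g
  -- `even_le` starts in degree four; degree two is condition `two` alone.
  match k with
  | 0 =>
    have := Module.Finite.iff_fg.2 ((hW.sup hu).sup hv)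
    have i1 := Submodule.finrank_mono h2
    have i2 := finrank_sup_le _ _ (hW.sup hu) hv
    have i3 := finrank_sup_le _ _ hW hu
    have j1 := finrank_span_singleton_le (K := ℂ) u
    have j2 := finrank_span_singleton_le (K := ℂ) v
    rw [zero_add, mul_one, pow_one]
    omega
  | k + 1 =>
    have f1 := (hW.pow (k + 2)).sup ((hV.pow (k + 1)).mul hu)
    have f2 := f1.sup ((hV.pow (k + 1)).mul hv)
    have := Module.Finite.iff_fg.2 (f2.sup ((hV.pow k).mul hg))
    have i0 := Submodule.finrank_mono (he k)
    have i1 := finrank_sup_le _ _ f2 ((hV.pow k).mul hg)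
    have i2 := finrank_sup_le _ _ f1 ((hV.pow (k + 1)).mul hv)
    have i3 := finrank_sup_le _ _ (hW.pow (k + 2)) ((hV.pow (k + 1)).mul hu)
    have j1 := finrank_mul_span_singleton_le _ (hV.pow (k + 1)) u
    have j2 := finrank_mul_span_singleton_le _ (hV.pow (k + 1)) v
    have j3 := finrank_mul_span_singleton_le _ (hV.pow k) g
    have := hVn (k + 1)
    have := hVn k
    rw [show k + 1 + 1 = k + 2 from rfl]
    omega

/-- The products `d * d`, `d * u`, `d * v` are quartics, hence lie in `⟨a, b, c⟩` times the quadrics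
by `four`; expanding the quadrics by `two` gives the input of the determinant trick. -/
theorem finrank_pow_le (h : SpanConditions a b c d u v g)
    (hu : u ∈ ternaryForms 2) (hv : v ∈ ternaryForms 2) (k : ℕ) :
    Module.finrank ℂ ↥(((ℂ ∙ a) ⊔ (ℂ ∙ b) ⊔ (ℂ ∙ c) ⊔ (ℂ ∙ d)) ^ (k + 1)) ≤
      2 * (k + 1) ^ 2 + 2 := by
  refine finrank_span_four_pow_le (pow_four_mem_of_mul_mem (u := u) (v := v) fun w hw => ?_) k
  have hd : d ∈ ternaryForms 2 :=
    h.isQuadric (Submodule.mem_sup_right (Submodule.mem_span_singleton_self d))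
  refine mul_le_mul_right h.two _ (h.four ?_)
  rw [show 4 = 2 + 2 from rfl, ternaryForms_add]
  refine Submodule.mul_mem_mul hd ?_
  rcases hw with rfl | rfl | rfl
  exacts [hd, hu, hv]

/-- The two bounds meet: with `m = k + 1`, `(2m² + 2) + (3m - 1) = (2m + 2).choose 2`. -/
theorem finrank_pow (h : SpanConditions a b c d u v g)
    (hu : u ∈ ternaryForms 2) (hv : v ∈ ternaryForms 2) (k : ℕ) :
    Module.finrank ℂ ↥(((ℂ ∙ a) ⊔ (ℂ ∙ b) ⊔ (ℂ ∙ c) ⊔ (ℂ ∙ d)) ^ (k + 1)) + (3 * k + 2) =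
      Module.finrank ℂ (ternaryForms (2 * (k + 1))) := by
  refine le_antisymm ?_ (h.finrank_even_le k)
  have h1 := h.finrank_pow_le hu hv k
  have h2 := two_mul_choose_two (2 * (k + 1) + 1)
  rw [finrank_ternaryForms]
  nlinarith

end SpanConditions

end GeneralQuadrics

/-! ### From the powers of the span to the Hilbert series -/

section PowersOfIdeals

open scoped Pointwise

/-- In a combination `∑ q t` with `t` of degree `d`, the degree `i` part sees only the component of
`q` of degree `i - d`: nothing for `i < d`, a constant for `i = d`. -/
theorem homogeneousComponent_mem_span_of_mem_ideal_span {σ K : Type*} [Field K] {d : ℕ}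
    {T : Set (MvPolynomial σ K)} (hT : T ⊆ homogeneousSubmodule σ K d) {p : MvPolynomial σ K}
    (hp : p ∈ Ideal.span T) :
    (∀ i < d, homogeneousComponent i p = 0) ∧
      homogeneousComponent d p ∈ Submodule.span K T := by
  classical
  have key : ∀ (q t : MvPolynomial σ K) (i : ℕ), t ∈ T → homogeneousComponent i (q * t) =
      if d ≤ i then homogeneousComponent (i - d) q * t else 0 := by
    intro q t i ht
    let _ : GradedAlgebra (homogeneousSubmodule σ K) := MvPolynomial.gradedAlgebra
    have hdec : ∀ (p : MvPolynomial σ K) (i : ℕ),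
        (DirectSum.decompose (homogeneousSubmodule σ K) p i : MvPolynomial σ K) =
          homogeneousComponent i p := fun p i => decomposition.decompose'_apply p i
    simpa only [hdec] using
      DirectSum.coe_decompose_mul_of_right_mem (homogeneousSubmodule σ K) (a := q) i (hT ht)
  obtain ⟨n, q, t, rfl⟩ := Submodule.mem_span_set'.1 hp
  simp only [map_sum, smul_eq_mul]
  refine ⟨fun i hi => Finset.sum_eq_zero fun j _ => ?_, sum_mem fun j _ => ?_⟩
  · rw [key _ _ _ (t j).2, if_neg (by omega)]
  · rw [key _ _ _ (t j).2, if_pos le_rfl, Nat.sub_self, homogeneousComponent_zero, ← smul_eq_C_mul]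
    exact Submodule.smul_mem _ _ (Submodule.subset_span (t j).2)

theorem mem_ideal_span_iff_mem_span {σ K : Type*} [Field K] {d : ℕ}
    {T : Set (MvPolynomial σ K)} (hT : T ⊆ homogeneousSubmodule σ K d) {p : MvPolynomial σ K}
    (hp : p ∈ homogeneousSubmodule σ K d) :
    p ∈ Ideal.span T ↔ p ∈ Submodule.span K T := by
  refine ⟨fun h => ?_, fun h => Submodule.span_le_restrictScalars K _ T h⟩
  rw [← homogeneousComponent_eq_self hp]
  exact (homogeneousComponent_mem_span_of_mem_ideal_span hT h).2

theorem eq_zero_of_mem_ideal_span {σ K : Type*} [Field K] {d i : ℕ} (hi : i < d)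
    {T : Set (MvPolynomial σ K)} (hT : T ⊆ homogeneousSubmodule σ K d) {p : MvPolynomial σ K}
    (hp : p ∈ homogeneousSubmodule σ K i) (h : p ∈ Ideal.span T) : p = 0 := by
  rw [← homogeneousComponent_eq_self hp]
  exact (homogeneousComponent_mem_span_of_mem_ideal_span hT h).1 i hi

theorem finrank_quotientComponent_add {n : ℕ} (J : Ideal (MvPolynomial (Fin n) ℂ)) (i : ℕ)
    {N : Submodule ℂ (MvPolynomial (Fin n) ℂ)} (hN : N ≤ homogeneousSubmodule (Fin n) ℂ i)
    (h : ∀ p ∈ homogeneousSubmodule (Fin n) ℂ i, p ∈ J ↔ p ∈ N) :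
    Module.finrank ℂ (quotientComponent J i) + Module.finrank ℂ N =
      Module.finrank ℂ (homogeneousSubmodule (Fin n) ℂ i) := by
  have : Module.Finite ℂ (homogeneousSubmodule (Fin n) ℂ i) :=
    Module.Finite.iff_fg.2 (homogeneousSubmodule_fg (σ := Fin n) (R := ℂ) i)
  let φ := (Ideal.Quotient.mkₐ ℂ J).toLinearMap ∘ₗ (homogeneousSubmodule (Fin n) ℂ i).subtype
  have hr : LinearMap.range φ = quotientComponent J i := by
    rw [LinearMap.range_comp, Submodule.range_subtype, quotientComponent]
  have hk : LinearMap.ker φ = N.comap (homogeneousSubmodule (Fin n) ℂ i).subtype := by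
    ext p
    rw [Submodule.mem_comap, Submodule.subtype_apply, ← h p p.2, LinearMap.mem_ker]
    exact Ideal.Quotient.eq_zero_iff_mem
  rw [← LinearMap.finrank_range_add_finrank_ker φ, hr, hk,
    (Submodule.comapSubtypeEquivOfLe hN).finrank_eq]

/-- The power of the ideal is generated by the `k`-fold products, all of degree `2k`. Degrees below,
at and above `2k` use respectively the absence of low-degree elements, `finrank_pow`, and `odd_le`.
-/
theorem SpanConditions.hilbertSeries_pow {f : Fin 4 → MvPolynomial (Fin 3) ℂ}
    {u v g : MvPolynomial (Fin 3) ℂ} (h : SpanConditions (f 0) (f 1) (f 2) (f 3) u v g)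
    (hu : u ∈ ternaryForms 2) (hv : v ∈ ternaryForms 2) {k : ℕ} (hk : 1 ≤ k) :
    hilbertSeries (Ideal.span (Set.range f) ^ k) =
      (∑ i ∈ Finset.range (2 * k),
          PowerSeries.C (((i + 2).choose 2 : ℕ) : ℤ) * PowerSeries.X ^ i) +
        PowerSeries.C (3 * (k : ℤ) - 1) * PowerSeries.X ^ (2 * k) := by
  have hW : (ℂ ∙ f 0) ⊔ (ℂ ∙ f 1) ⊔ (ℂ ∙ f 2) ⊔ (ℂ ∙ f 3) = Submodule.span ℂ (Set.range f) := by
    rw [← Submodule.span_union, ← Submodule.span_union, ← Submodule.span_union]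
    congr 1
    ext p
    simp only [Set.union_singleton, Set.mem_insert_iff, Set.mem_singleton_iff, Set.mem_range,
      Fin.exists_fin_succ]
    simp [eq_comm]
    tauto
  have hodd := h.odd_le
  have hdim := h.finrank_pow hu hv
  have hquad := h.isQuadric
  rw [hW] at hquad hodd hdim
  have hpowle : Submodule.span ℂ (Set.range f) ^ k ≤ ternaryForms (2 * k) := by
    refine (pow_le_pow_left' hquad k).trans ?_
    have h1 := homogeneousSubmodule_one_pow (σ := Fin 3) (R := ℂ)
    rw [ternaryForms, ternaryForms, ← h1 2, ← h1 (2 * k), pow_mul]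
  rw [Submodule.span_pow] at hpowle
  have hT : Set.range f ^ k ⊆ homogeneousSubmodule (Fin 3) ℂ (2 * k) :=
    Submodule.subset_span.trans hpowle
  have hJ : Ideal.span (Set.range f) ^ k = Ideal.span (Set.range f ^ k) := Submodule.span_pow _ _
  rw [hJ]
  ext i
  have hcoeff : PowerSeries.coeff i ((∑ i ∈ Finset.range (2 * k),
          PowerSeries.C (((i + 2).choose 2 : ℕ) : ℤ) * PowerSeries.X ^ i) +
        PowerSeries.C (3 * (k : ℤ) - 1) * PowerSeries.X ^ (2 * k)) =
      (if i < 2 * k then (((i + 2).choose 2 : ℕ) : ℤ) else 0) +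
        if i = 2 * k then 3 * (k : ℤ) - 1 else 0 := by
    simp only [map_add, map_sum, PowerSeries.coeff_C_mul, PowerSeries.coeff_X_pow, mul_ite, mul_one,
      mul_zero, Finset.sum_ite_eq, Finset.mem_range]
  rw [hcoeff, hilbertSeries, PowerSeries.coeff_mk]
  rcases lt_trichotomy i (2 * k) with hi | rfl | hi
  · rw [if_pos hi, if_neg hi.ne, add_zero, ← finrank_ternaryForms,
      ← finrank_quotientComponent_add (Ideal.span (Set.range f ^ k)) i (N := ⊥) bot_le, finrank_bot,
      add_zero]
    intro p hp
    refine ⟨fun h => (Submodule.mem_bot ℂ).2 (eq_zero_of_mem_ideal_span hi hT hp h), fun h => ?_⟩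
    rw [(Submodule.mem_bot ℂ).1 h]
    exact zero_mem _
  · rw [if_neg (lt_irrefl _), if_pos rfl, zero_add]
    have h1 : _ = Module.finrank ℂ (ternaryForms (2 * k)) :=
      finrank_quotientComponent_add (Ideal.span (Set.range f ^ k)) (2 * k) hpowle
        fun p hp => mem_ideal_span_iff_mem_span hT hp
    have h2 := hdim (k - 1)
    rw [Nat.sub_add_cancel hk, Submodule.span_pow] at h2
    omega
  · rw [if_neg hi.not_gt, if_neg hi.ne', add_zero]
    have hle : ternaryForms i ≤ (Ideal.span (Set.range f ^ k)).restrictScalars ℂ := by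
      obtain ⟨j, rfl⟩ := Nat.exists_eq_add_of_lt hi
      -- Containing all forms of degree `2k + 1` suffices, since they generate all higher degrees.
      rw [show 2 * k + j + 1 = (2 * k + 1) + j by ring, ternaryForms_add, Submodule.mul_le]
      intro p hp q _
      refine Ideal.mul_mem_right _ _ ?_
      refine (Submodule.mul_le.2 ?_ : _ ≤ (Ideal.span (Set.range f ^ k)).restrictScalars ℂ)
        (hodd k hp)
      intro r hr s _
      rw [Submodule.span_pow] at hr
      exact Ideal.mul_mem_right _ _ (Submodule.span_le_restrictScalars ℂ _ _ hr)
    have h1 := finrank_quotientComponent_add (Ideal.span (Set.range f ^ k)) i le_rfl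
      fun p hp => ⟨fun _ => hp, fun hp => hle hp⟩
    omega

end PowersOfIdeals

/-! ### Generic forms and their specializations -/

section Genericity

/-- The coefficients of a tuple of forms, as a point at which generic coefficients are evaluated. -/
noncomputable abbrev coefficientPoint {n d r : ℕ} (f : FormTuple n d r) :
    Fin r × (Fin n →₀ ℕ) → ℂ :=
  fun p => coeff p.2 (f p.1 : MvPolynomial (Fin n) ℂ)

/-- The `j`-th generic form of degree `d` in `n` variables. -/
noncomputable def genericForm (n d r : ℕ) (j : Fin r) :
    MvPolynomial (Fin n) (MvPolynomial (Fin r × (Fin n →₀ ℕ)) ℂ) :=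
  ∑ m ∈ Finset.univ.finsuppAntidiag d, monomial m (X (j, m))

theorem isHomogeneous_genericForm (n d r : ℕ) (j : Fin r) :
    (genericForm n d r j).IsHomogeneous d := by
  refine IsHomogeneous.sum _ _ _ fun m hm => isHomogeneous_monomial _ ?_
  rw [Finsupp.degree_eq_sum]
  exact (Finset.mem_finsuppAntidiag.1 hm).1

theorem map_genericForm {n d r : ℕ} (f : FormTuple n d r) (j : Fin r) :
    map (eval (coefficientPoint f)) (genericForm n d r j) = f j := by
  classical
  ext m
  simp only [genericForm, map_sum, map_monomial, eval_X, coeff_sum, coeff_monomial,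
    Finset.sum_ite_eq', Finset.mem_finsuppAntidiag]
  split_ifs with h
  · rfl
  · refine (IsHomogeneous.coeff_eq_zero (f j).2 fun hm => h ⟨?_, by simp⟩).symm
    rw [← hm, Finsupp.degree_eq_sum]

theorem map_map_C {n : ℕ} {τ : Type*} (c : τ → ℂ) (q : MvPolynomial (Fin n) ℂ) :
    map (eval c) (map C q) = q := by
  rw [map_map, show (eval c).comp C = RingHom.id ℂ from RingHom.ext fun x => eval_C x, map_id]

/-- The specializations at `f₀` of the generic forms of degree `i` whose specialization at each `f`
lies in `N f`. -/
noncomputable def specializations {n d r : ℕ}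
    (N : FormTuple n d r → Submodule ℂ (MvPolynomial (Fin n) ℂ))
    (i : ℕ) (f₀ : FormTuple n d r) : Submodule ℂ (MvPolynomial (Fin n) ℂ) :=
  Submodule.span ℂ {p | ∃ v : MvPolynomial (Fin n) (MvPolynomial (Fin r × (Fin n →₀ ℕ)) ℂ),
    v.IsHomogeneous i ∧ (∀ f, map (eval (coefficientPoint f)) v ∈ N f) ∧
      map (eval (coefficientPoint f₀)) v = p}

/-- Reduces a generic statement to a check at `f₀`: the spanning elements there come from polynomial
families lying in `N f` for every `f`, so spanning persists on a principal open set. -/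
theorem exists_eval_ne_zero_of_le_specializations {n d r i : ℕ}
    {N : FormTuple n d r → Submodule ℂ (MvPolynomial (Fin n) ℂ)} {f₀ : FormTuple n d r}
    (h : homogeneousSubmodule (Fin n) ℂ i ≤ specializations N i f₀) :
    ∃ P : MvPolynomial (Fin r × (Fin n →₀ ℕ)) ℂ, eval (coefficientPoint f₀) P ≠ 0 ∧
      ∀ f, eval (coefficientPoint f) P ≠ 0 → homogeneousSubmodule (Fin n) ℂ i ≤ N f := by
  let ι := {v : MvPolynomial (Fin n) (MvPolynomial (Fin r × (Fin n →₀ ℕ)) ℂ) //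
    v.IsHomogeneous i ∧ ∀ f, map (eval (coefficientPoint f)) v ∈ N f}
  obtain ⟨P, hP, hP'⟩ := exists_eval_ne_zero_of_le_span (fun v : ι => v.1) (fun v => v.2.1)
    (coefficientPoint f₀) (h.trans (Submodule.span_mono (by
      rintro _ ⟨v, hv, hv', rfl⟩
      exact ⟨⟨v, hv, hv'⟩, rfl⟩)))
  refine ⟨P, hP, fun f hf => (hP' _ hf).trans (Submodule.span_le.2 ?_)⟩
  rintro _ ⟨v, rfl⟩
  exact v.2.2 f

/-- A product of some of the forms with a fixed form lifts to the same product of generic forms. -/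
theorem mem_specializations {n d r i : ℕ}
    {N : FormTuple n d r → Submodule ℂ (MvPolynomial (Fin n) ℂ)} {f₀ : FormTuple n d r}
    (s : Multiset (Fin r)) {q : MvPolynomial (Fin n) ℂ} {e : ℕ} (hq : q.IsHomogeneous e)
    (he : s.card * d + e = i)
    (h : ∀ f : FormTuple n d r, (s.map fun j => (f j : MvPolynomial (Fin n) ℂ)).prod * q ∈ N f) :
    (s.map fun j => (f₀ j : MvPolynomial (Fin n) ℂ)).prod * q ∈ specializations N i f₀ := by
  have key : ∀ f : FormTuple n d r,
      map (eval (coefficientPoint f)) ((s.map (genericForm n d r)).prod * map C q) =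
        (s.map fun j => (f j : MvPolynomial (Fin n) ℂ)).prod * q := by
    intro f
    rw [map_mul, map_map_C, map_multiset_prod, Multiset.map_map]
    simp only [Function.comp_def, map_genericForm]
  refine Submodule.subset_span ⟨(s.map (genericForm n d r)).prod * map C q, ?_, fun f => ?_, key f₀⟩
  · rw [← he]
    refine IsHomogeneous.mul ?_ (hq.map _)
    clear key he h
    induction s using Multiset.induction_on with
    | empty => simpa using isHomogeneous_one _ _
    | cons j s ih =>
      rw [Multiset.map_cons, Multiset.prod_cons, Multiset.card_cons, add_mul, one_mul, add_comm]
      exact (isHomogeneous_genericForm n d r j).mul ih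
  · rw [key]
    exact h f

theorem mul_mem_specializations {n d r i : ℕ}
    {N : FormTuple n d r → Submodule ℂ (MvPolynomial (Fin n) ℂ)} {f₀ : FormTuple n d r}
    (j : Fin r) {q : MvPolynomial (Fin n) ℂ} {e : ℕ} (hq : q.IsHomogeneous e)
    (he : d + e = i) (h : ∀ f : FormTuple n d r, (f j : MvPolynomial (Fin n) ℂ) * q ∈ N f) :
    (f₀ j : MvPolynomial (Fin n) ℂ) * q ∈ specializations N i f₀ := by
  simpa using mem_specializations (f₀ := f₀) {j} hq (by simpa using he) (by simpa using h)

theorem mem_specializations_of_forall_mem {n d r i : ℕ}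
    {N : FormTuple n d r → Submodule ℂ (MvPolynomial (Fin n) ℂ)} {f₀ : FormTuple n d r}
    {q : MvPolynomial (Fin n) ℂ} (hq : q.IsHomogeneous i) (h : ∀ f, q ∈ N f) :
    q ∈ specializations N i f₀ := by
  simpa using mem_specializations (f₀ := f₀) 0 hq (by simp) (by simpa using h)

theorem prod_mem_specializations {n d r i : ℕ}
    {N : FormTuple n d r → Submodule ℂ (MvPolynomial (Fin n) ℂ)} {f₀ : FormTuple n d r}
    (s : Multiset (Fin r)) (he : s.card * d = i)
    (h : ∀ f : FormTuple n d r, (s.map fun j => (f j : MvPolynomial (Fin n) ℂ)).prod ∈ N f) :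
    (s.map fun j => (f₀ j : MvPolynomial (Fin n) ℂ)).prod ∈ specializations N i f₀ := by
  simpa using mem_specializations (f₀ := f₀) s (isHomogeneous_one (Fin n) ℂ) (by simpa using he)
    (by simpa using h)

theorem IsZariskiOpen.of_eval_ne_zero {n d r : ℕ}
    (P : MvPolynomial (Fin r × (Fin n →₀ ℕ)) ℂ) :
    IsZariskiOpen {f : FormTuple n d r | eval (coefficientPoint f) P ≠ 0} :=
  ⟨{P}, by simp⟩

end Genericity

/-! ### Verification at an explicit quadruple of quadrics -/

section Witness

/-- Modulo `x² - z²` and `y² - z²`, squares of `x` and `y` become `z²`, which leaves four monomials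
to check in each degree. -/
theorem ternaryForms_le_of_mem (N : Submodule ℂ (MvPolynomial (Fin 3) ℂ)) (n : ℕ)
    (h0 : ∀ q ∈ ternaryForms n, (X 0 ^ 2 - X 2 ^ 2) * q ∈ N)
    (h1 : ∀ q ∈ ternaryForms n, (X 1 ^ 2 - X 2 ^ 2) * q ∈ N)
    (hz : X 2 ^ (n + 2) ∈ N) (hx : X 0 * X 2 ^ (n + 1) ∈ N) (hy : X 1 * X 2 ^ (n + 1) ∈ N)
    (hxy : X 0 * X 1 * X 2 ^ n ∈ N) : ternaryForms (n + 2) ≤ N := by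
  have key : ∀ i j k : ℕ, i + j + k = n + 2 →
      (X 0 ^ i * X 1 ^ j * X 2 ^ k : MvPolynomial (Fin 3) ℂ) ∈ N := by
    have hom : ∀ i j k : ℕ, i + j + k = n →
        (X 0 ^ i * X 1 ^ j * X 2 ^ k : MvPolynomial (Fin 3) ℂ) ∈ ternaryForms n := by
      rintro i j k rfl
      exact ((isHomogeneous_X_pow 0 i).mul (isHomogeneous_X_pow 1 j)).mul (isHomogeneous_X_pow 2 k)
    intro i
    induction i using Nat.strong_induction_on with
    | _ i ihi =>
      intro j
      induction j using Nat.strong_induction_on with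
      | _ j ihj =>
        intro k hk
        match i, j with
        | i + 2, j =>
          have e1 := h0 _ (hom i j k (by omega))
          have e2 := ihi i (by omega) j (k + 2) (by omega)
          convert add_mem e1 e2 using 1
          ring
        | i, j + 2 =>
          have e1 := h1 _ (hom i j k (by omega))
          have e2 := ihj j (by omega) (k + 2) (by omega)
          convert add_mem e1 e2 using 1
          ring
        | 0, 0 =>
          obtain rfl : k = n + 2 := by omega
          simpa using hz
        | 1, 0 =>
          obtain rfl : k = n + 1 := by omega
          simpa using hx
        | 0, 1 =>
          obtain rfl : k = n + 1 := by omega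
          simpa using hy
        | 1, 1 =>
          obtain rfl : k = n := by omega
          simpa using hxy
  rw [ternaryForms, homogeneousSubmodule_eq_restrictSupport, restrictSupport_eq_span,
    Submodule.span_le]
  rintro _ ⟨m, hm, rfl⟩
  have hm' : m 0 + m 1 + m 2 = n + 2 := by
    rw [← Fin.sum_univ_three, ← Finsupp.degree_eq_sum]
    exact hm
  have := key _ _ _ hm'
  rw [← Fin.prod_univ_three (fun i => (X i : MvPolynomial (Fin 3) ℂ) ^ m i)] at this
  change monomial m 1 ∈ N
  rw [monomial_eq, C_1, one_mul, Finsupp.prod_fintype _ _ fun i => pow_zero _]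
  exact this

/-- The quadrics `x² - z², y² - z², z², xz + 2yz`. -/
noncomputable def witnessQuadrics : FormTuple 3 2 4 :=
  ![⟨X 0 ^ 2 - X 2 ^ 2, (isHomogeneous_X_pow 0 2).sub (isHomogeneous_X_pow 2 2)⟩,
    ⟨X 1 ^ 2 - X 2 ^ 2, (isHomogeneous_X_pow 1 2).sub (isHomogeneous_X_pow 2 2)⟩,
    ⟨X 2 ^ 2, isHomogeneous_X_pow 2 2⟩,
    ⟨X 0 * X 2 + C 2 * (X 1 * X 2), ((isHomogeneous_X ℂ 0).mul (isHomogeneous_X ℂ 2)).add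
      (((isHomogeneous_X ℂ 1).mul (isHomogeneous_X ℂ 2)).C_mul 2)⟩]

/-- The span of the first two forms of a quadruple of quadrics. -/
noncomputable abbrev spanTwo (f : FormTuple 3 2 4) : Submodule ℂ (MvPolynomial (Fin 3) ℂ) :=
  (ℂ ∙ (f 0 : MvPolynomial (Fin 3) ℂ)) ⊔ (ℂ ∙ (f 1 : MvPolynomial (Fin 3) ℂ))

/-- The span of the first three forms of a quadruple of quadrics. -/
noncomputable abbrev spanThree (f : FormTuple 3 2 4) : Submodule ℂ (MvPolynomial (Fin 3) ℂ) :=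
  spanTwo f ⊔ (ℂ ∙ (f 2 : MvPolynomial (Fin 3) ℂ))

/-- The span of a quadruple of quadrics. -/
noncomputable abbrev spanFour (f : FormTuple 3 2 4) : Submodule ℂ (MvPolynomial (Fin 3) ℂ) :=
  spanThree f ⊔ (ℂ ∙ (f 3 : MvPolynomial (Fin 3) ℂ))

variable (f : FormTuple 3 2 4)

theorem zero_mem_spanTwo : (f 0 : MvPolynomial (Fin 3) ℂ) ∈ spanTwo f :=
  Submodule.mem_sup_left (Submodule.mem_span_singleton_self _)

theorem one_mem_spanTwo : (f 1 : MvPolynomial (Fin 3) ℂ) ∈ spanTwo f :=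
  Submodule.mem_sup_right (Submodule.mem_span_singleton_self _)

theorem two_mem_spanThree : (f 2 : MvPolynomial (Fin 3) ℂ) ∈ spanThree f :=
  Submodule.mem_sup_right (Submodule.mem_span_singleton_self _)

theorem mem_spanFour (j : Fin 4) : (f j : MvPolynomial (Fin 3) ℂ) ∈ spanFour f := by
  fin_cases j
  · exact Submodule.mem_sup_left (Submodule.mem_sup_left (zero_mem_spanTwo f))
  · exact Submodule.mem_sup_left (Submodule.mem_sup_left (one_mem_spanTwo f))
  · exact Submodule.mem_sup_left (two_mem_spanThree f)
  · exact Submodule.mem_sup_right (Submodule.mem_span_singleton_self _)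

theorem spanFour_le : spanFour f ≤ ternaryForms 2 := by
  simp only [sup_le_iff, Submodule.span_singleton_le_iff_mem, SetLike.coe_mem, and_self]

theorem prod_mem_spanFour_pow (s : Multiset (Fin 4)) :
    (s.map fun j => (f j : MvPolynomial (Fin 3) ℂ)).prod ∈ spanFour f ^ s.card := by
  induction s using Multiset.induction_on with
  | empty =>
    rw [Multiset.map_zero, Multiset.prod_zero, Multiset.card_zero, pow_zero]
    exact Submodule.one_le.1 le_rfl
  | cons j s ih =>
    rw [Multiset.map_cons, Multiset.prod_cons, Multiset.card_cons, pow_succ']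
    exact Submodule.mul_mem_mul (mem_spanFour f j) ih

variable (N : FormTuple 3 2 4 → Submodule ℂ (MvPolynomial (Fin 3) ℂ))

theorem isHomogeneous_X_mul_X_pow {σ : Type*} (i j : σ) (n : ℕ) :
    (X i * X j ^ n : MvPolynomial σ ℂ).IsHomogeneous (n + 1) := by
  rw [add_comm]
  exact (isHomogeneous_X ℂ i).mul (isHomogeneous_X_pow j n)

theorem ternaryForms_le_specializations_witness {n : ℕ}
    (h : ∀ f, spanTwo f * ternaryForms n ≤ N f)
    (hz : X 2 ^ (n + 2) ∈ specializations N (n + 2) witnessQuadrics)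
    (hx : X 0 * X 2 ^ (n + 1) ∈ specializations N (n + 2) witnessQuadrics)
    (hy : X 1 * X 2 ^ (n + 1) ∈ specializations N (n + 2) witnessQuadrics)
    (hxy : X 0 * X 1 * X 2 ^ n ∈ specializations N (n + 2) witnessQuadrics) :
    ternaryForms (n + 2) ≤ specializations N (n + 2) witnessQuadrics := by
  refine ternaryForms_le_of_mem _ n (fun q hq => ?_) (fun q hq => ?_) hz hx hy hxy
  · exact mul_mem_specializations (f₀ := witnessQuadrics) 0 hq (add_comm _ _) fun f =>
      h f (Submodule.mul_mem_mul (zero_mem_spanTwo f) hq)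
  · exact mul_mem_specializations (f₀ := witnessQuadrics) 1 hq (add_comm _ _) fun f =>
      h f (Submodule.mul_mem_mul (one_mem_spanTwo f) hq)

theorem witness_two : ternaryForms 2 ≤
    specializations (fun f => spanFour f ⊔ (ℂ ∙ X 0 * X 2) ⊔ (ℂ ∙ X 0 * X 1)) 2
      witnessQuadrics := by
  set N : FormTuple 3 2 4 → Submodule ℂ (MvPolynomial (Fin 3) ℂ) :=
    fun f => spanFour f ⊔ (ℂ ∙ X 0 * X 2) ⊔ (ℂ ∙ X 0 * X 1)
  have hW : ∀ j : Fin 4, (witnessQuadrics j : MvPolynomial (Fin 3) ℂ) ∈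
      specializations N 2 witnessQuadrics := fun j => by
    simpa using prod_mem_specializations (N := N) (f₀ := witnessQuadrics) {j} (by simp) fun f => by
      simpa using Submodule.mem_sup_left (Submodule.mem_sup_left (mem_spanFour f j))
  have hu : (X 0 * X 2 : MvPolynomial (Fin 3) ℂ) ∈
      specializations N 2 witnessQuadrics :=
    mem_specializations_of_forall_mem ((isHomogeneous_X ℂ 0).mul (isHomogeneous_X ℂ 2)) fun f =>
      Submodule.mem_sup_left (Submodule.mem_sup_right (Submodule.mem_span_singleton_self _))
  have hv : (X 0 * X 1 : MvPolynomial (Fin 3) ℂ) ∈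
      specializations N 2 witnessQuadrics :=
    mem_specializations_of_forall_mem ((isHomogeneous_X ℂ 0).mul (isHomogeneous_X ℂ 1)) fun f =>
      Submodule.mem_sup_right (Submodule.mem_span_singleton_self _)
  refine ternaryForms_le_specializations_witness (n := 0) _ (fun f => ?_) (hW 2) ?_ ?_ ?_
  · rw [ternaryForms, homogeneousSubmodule_zero, mul_one]
    exact le_sup_left.trans (le_sup_left.trans (le_sup_left.trans le_sup_left))
  · simpa using hu
  · have h3 : X 0 * X 2 + C 2 * (X 1 * X 2) ∈ specializations N 2 witnessQuadrics := hW 3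
    convert Submodule.smul_mem _ (2⁻¹ : ℂ) (sub_mem h3 hu) using 1
    rw [add_sub_cancel_left, ← smul_eq_C_mul, smul_smul]
    norm_num
  · simpa using hv

theorem witness_three : ternaryForms 3 ≤
    specializations (fun f => spanFour f * ternaryForms 1) 3 witnessQuadrics := by
  set N : FormTuple 3 2 4 → Submodule ℂ (MvPolynomial (Fin 3) ℂ) :=
    fun f => spanFour f * ternaryForms 1
  have hW : ∀ (j : Fin 4) (q : MvPolynomial (Fin 3) ℂ), q.IsHomogeneous 1 →
      (witnessQuadrics j : MvPolynomial (Fin 3) ℂ) * q ∈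
        specializations N 3 witnessQuadrics :=
    fun j q hq => mul_mem_specializations j hq rfl fun f =>
      Submodule.mul_mem_mul (mem_spanFour f j) hq
  have hz : X 2 ^ 2 * X 2 ∈ specializations N 3 witnessQuadrics :=
    hW 2 (X 2) (isHomogeneous_X ℂ 2)
  refine ternaryForms_le_specializations_witness (n := 1) _ (fun f => ?_) ?_ ?_ ?_ ?_
  · exact mul_le_mul_left (le_sup_left.trans le_sup_left) _
  · rw [pow_succ]; exact hz
  · rw [mul_comm]; exact hW 2 (X 0) (isHomogeneous_X ℂ 0)
  · rw [mul_comm]; exact hW 2 (X 1) (isHomogeneous_X ℂ 1)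
  · have h0 : (X 0 ^ 2 - X 2 ^ 2) * X 2 ∈ specializations N 3 witnessQuadrics :=
    hW 0 (X 2) (isHomogeneous_X ℂ 2)
    have h3 : (X 0 * X 2 + C 2 * (X 1 * X 2)) * X 0 ∈ specializations N 3 witnessQuadrics :=
    hW 3 (X 0) (isHomogeneous_X ℂ 0)
    have h := Submodule.smul_mem _ (2⁻¹ : ℂ) (sub_mem (sub_mem h3 h0) hz)
    convert h using 1
    have h2 : (C 2⁻¹ * C 2 : MvPolynomial (Fin 3) ℂ) = 1 := by rw [← C_mul]; norm_num
    rw [smul_eq_C_mul]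
    linear_combination -(X 0 * X 1 * X 2) * h2

theorem witness_four : ternaryForms 4 ≤
    specializations (fun f => spanThree f * ternaryForms 2) 4 witnessQuadrics := by
  have hW : ∀ q : MvPolynomial (Fin 3) ℂ, q.IsHomogeneous 2 → X 2 ^ 2 * q ∈
        specializations (fun f => spanThree f * ternaryForms 2) 4 witnessQuadrics :=
    fun q hq => mul_mem_specializations (f₀ := witnessQuadrics) 2 hq rfl fun f =>
      Submodule.mul_mem_mul (two_mem_spanThree f) hq
  refine ternaryForms_le_specializations_witness (n := 2) _ (fun f => ?_) ?_ ?_ ?_ ?_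
  · exact mul_le_mul_left le_sup_left _
  · convert hW _ (isHomogeneous_X_pow 2 2) using 1; ring
  · convert hW _ ((isHomogeneous_X ℂ 0).mul (isHomogeneous_X ℂ 2)) using 1; ring
  · convert hW _ ((isHomogeneous_X ℂ 1).mul (isHomogeneous_X ℂ 2)) using 1; ring
  · convert hW _ ((isHomogeneous_X ℂ 0).mul (isHomogeneous_X ℂ 1)) using 1; ring

theorem C_natCast_eq (n : ℕ) : (C (n : ℂ) : MvPolynomial (Fin 3) ℂ) = n := map_natCast C n

/-- Modulo the first two quadrics, the products of `z²` and `xz + 2yz` give `z⁴`, `xz³ + 2yz³` and,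
from the square, `xyz²`. The auxiliary quartic `xz³` supplies the missing direction. -/
theorem witness_four' : ternaryForms 4 ≤
    specializations (fun f => spanFour f ^ 2 ⊔ spanTwo f * ternaryForms 2 ⊔ (ℂ ∙ X 0 * X 2 ^ 3)) 4
      witnessQuadrics := by
  set N : FormTuple 3 2 4 → Submodule ℂ (MvPolynomial (Fin 3) ℂ) :=
    fun f => spanFour f ^ 2 ⊔ spanTwo f * ternaryForms 2 ⊔ (ℂ ∙ X 0 * X 2 ^ 3)
  have hW : ∀ i j : Fin 4, (witnessQuadrics i : MvPolynomial (Fin 3) ℂ) * witnessQuadrics j ∈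
      specializations N 4 witnessQuadrics := fun i j => by
    simpa using prod_mem_specializations (N := N) (f₀ := witnessQuadrics) {i, j} (by simp)
      fun f => Submodule.mem_sup_left (Submodule.mem_sup_left
        (by simpa using prod_mem_spanFour_pow f {i, j}))
  have hV : ∀ f, spanTwo f * ternaryForms 2 ≤ N f := fun f => le_sup_right.trans le_sup_left
  have hx : X 0 * X 2 ^ 3 ∈ specializations N 4 witnessQuadrics :=
    mem_specializations_of_forall_mem (isHomogeneous_X_mul_X_pow 0 2 3) fun f =>
      Submodule.mem_sup_right (Submodule.mem_span_singleton_self _)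
  have h0 : (X 0 ^ 2 - X 2 ^ 2) * X 2 ^ 2 ∈ specializations N 4 witnessQuadrics := hW 0 2
  have h1 : (X 1 ^ 2 - X 2 ^ 2) * X 2 ^ 2 ∈ specializations N 4 witnessQuadrics := hW 1 2
  have h2 : X 2 ^ 2 * X 2 ^ 2 ∈ specializations N 4 witnessQuadrics := hW 2 2
  have h23 : X 2 ^ 2 * (X 0 * X 2 + C 2 * (X 1 * X 2)) ∈ specializations N 4 witnessQuadrics :=
    hW 2 3
  have h33 : (X 0 * X 2 + C 2 * (X 1 * X 2)) * (X 0 * X 2 + C 2 * (X 1 * X 2)) ∈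
    specializations N 4 witnessQuadrics := hW 3 3
  have e : (C 2⁻¹ * C 2 : MvPolynomial (Fin 3) ℂ) = 1 := by rw [← C_mul]; norm_num
  refine ternaryForms_le_specializations_witness (n := 2) _ hV ?_ hx ?_ ?_
  · convert h2 using 1; ring
  · convert Submodule.smul_mem _ (2⁻¹ : ℂ) (sub_mem h23 hx) using 1
    rw [smul_eq_C_mul]
    linear_combination -(X 1 * X 2 ^ 3) * e
  -- `(xz + 2yz)² ≡ 5z⁴ + 4xyz²` modulo the first two quadrics.
  · convert Submodule.smul_mem _ (4⁻¹ : ℂ) (sub_mem (sub_mem (sub_mem h33 h0)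
      (Submodule.smul_mem _ (4 : ℂ) h1)) (Submodule.smul_mem _ (5 : ℂ) h2)) using 1
    have e2 : (C 2 : MvPolynomial (Fin 3) ℂ) = 2 := C_natCast_eq 2
    have e4 : (C 4 : MvPolynomial (Fin 3) ℂ) = 4 := C_natCast_eq 4
    have e5 : (C 5 : MvPolynomial (Fin 3) ℂ) = 5 := C_natCast_eq 5
    have e' : (C 4⁻¹ * 4 : MvPolynomial (Fin 3) ℂ) = 1 := by rw [← e4, ← C_mul]; norm_num
    simp only [smul_eq_C_mul, e2, e4, e5]
    linear_combination -(X 0 * X 1 * X 2 ^ 2) * e'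

theorem witness_six : ternaryForms 6 ≤
    specializations (fun f => spanFour f ^ 3 ⊔ spanTwo f * ternaryForms 4) 6 witnessQuadrics := by
  set N : FormTuple 3 2 4 → Submodule ℂ (MvPolynomial (Fin 3) ℂ) :=
    fun f => spanFour f ^ 3 ⊔ spanTwo f * ternaryForms 4
  have hW : ∀ i j k : Fin 4, (witnessQuadrics i : MvPolynomial (Fin 3) ℂ) *
      (witnessQuadrics j * witnessQuadrics k) ∈ specializations N 6 witnessQuadrics :=
    fun i j k => by
      simpa using prod_mem_specializations (N := N) (f₀ := witnessQuadrics) {i, j, k} (by simp)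
        fun f => Submodule.mem_sup_left (by simpa using prod_mem_spanFour_pow f {i, j, k})
  have hV : ∀ f, spanTwo f * ternaryForms 4 ≤ N f := fun f => le_sup_right
  have h0 : ∀ q : MvPolynomial (Fin 3) ℂ, q.IsHomogeneous 4 →
      (X 0 ^ 2 - X 2 ^ 2) * q ∈ specializations N 6 witnessQuadrics := fun q hq =>
    mul_mem_specializations (f₀ := witnessQuadrics) 0 hq rfl fun f =>
      hV f (Submodule.mul_mem_mul (zero_mem_spanTwo f) hq)
  have h1 : ∀ q : MvPolynomial (Fin 3) ℂ, q.IsHomogeneous 4 →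
      (X 1 ^ 2 - X 2 ^ 2) * q ∈ specializations N 6 witnessQuadrics := fun q hq =>
    mul_mem_specializations (f₀ := witnessQuadrics) 1 hq rfl fun f =>
      hV f (Submodule.mul_mem_mul (one_mem_spanTwo f) hq)
  have h0z := h0 _ (isHomogeneous_X_pow 2 4)
  have h1z := h1 _ (isHomogeneous_X_pow 2 4)
  have h0x := h0 _ (isHomogeneous_X_mul_X_pow 0 2 3)
  have h0y := h0 _ (isHomogeneous_X_mul_X_pow 1 2 3)
  have h1x := h1 _ (isHomogeneous_X_mul_X_pow 0 2 3)
  have h1y := h1 _ (isHomogeneous_X_mul_X_pow 1 2 3)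
  have h222 : X 2 ^ 2 * (X 2 ^ 2 * X 2 ^ 2) ∈ specializations N 6 witnessQuadrics := hW 2 2 2
  have h223 : X 2 ^ 2 * (X 2 ^ 2 * (X 0 * X 2 + C 2 * (X 1 * X 2))) ∈
    specializations N 6 witnessQuadrics := hW 2 2 3
  have h233 : X 2 ^ 2 * ((X 0 * X 2 + C 2 * (X 1 * X 2)) * (X 0 * X 2 + C 2 * (X 1 * X 2))) ∈
    specializations N 6 witnessQuadrics := hW 2 3 3
  have h333 : (X 0 * X 2 + C 2 * (X 1 * X 2)) *
    ((X 0 * X 2 + C 2 * (X 1 * X 2)) * (X 0 * X 2 + C 2 * (X 1 * X 2))) ∈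
    specializations N 6 witnessQuadrics := hW 3 3 3
  have e2 : (C 2 : MvPolynomial (Fin 3) ℂ) = 2 := C_natCast_eq 2
  have e4 : (C 4 : MvPolynomial (Fin 3) ℂ) = 4 := C_natCast_eq 4
  have e5 : (C 5 : MvPolynomial (Fin 3) ℂ) = 5 := C_natCast_eq 5
  have e6 : (C 6 : MvPolynomial (Fin 3) ℂ) = 6 := C_natCast_eq 6
  have e7 : (C 7 : MvPolynomial (Fin 3) ℂ) = 7 := C_natCast_eq 7
  have e8 : (C 8 : MvPolynomial (Fin 3) ℂ) = 8 := C_natCast_eq 8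
  have e12 : (C 12 : MvPolynomial (Fin 3) ℂ) = 12 := C_natCast_eq 12
  -- `(xz + 2yz)³ ≡ 13xz⁵ + 14yz⁵` modulo the first two quadrics; subtracting `7(x + 2y)z⁵` leaves
  -- `6xz⁵`. With `xz + yz` instead, the cube would reduce to a multiple of `(x + y)z⁵` and give
  -- nothing new.
  have hx : X 0 * X 2 ^ 5 ∈ specializations N 6 witnessQuadrics := by
    convert Submodule.smul_mem _ (6⁻¹ : ℂ) (sub_mem (sub_mem (sub_mem (sub_mem (sub_mem h333 h0x)
      (Submodule.smul_mem _ (6 : ℂ) h0y)) (Submodule.smul_mem _ (12 : ℂ) h1x))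
      (Submodule.smul_mem _ (8 : ℂ) h1y)) (Submodule.smul_mem _ (7 : ℂ) h223)) using 1
    have e' : (C 6⁻¹ * 6 : MvPolynomial (Fin 3) ℂ) = 1 := by rw [← e6, ← C_mul]; norm_num
    simp only [smul_eq_C_mul, e2, e6, e7, e8, e12]
    linear_combination -(X 0 * X 2 ^ 5) * e'
  refine ternaryForms_le_specializations_witness (n := 4) _ hV ?_ hx ?_ ?_
  · convert h222 using 1; ring
  · convert Submodule.smul_mem _ (2⁻¹ : ℂ) (sub_mem h223 hx) using 1
    have e' : (C 2⁻¹ * 2 : MvPolynomial (Fin 3) ℂ) = 1 := by rw [← e2, ← C_mul]; norm_num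
    simp only [smul_eq_C_mul, e2]
    linear_combination -(X 1 * X 2 ^ 5) * e'
  · convert Submodule.smul_mem _ (4⁻¹ : ℂ) (sub_mem (sub_mem (sub_mem h233 h0z)
      (Submodule.smul_mem _ (4 : ℂ) h1z)) (Submodule.smul_mem _ (5 : ℂ) h222)) using 1
    have e' : (C 4⁻¹ * 4 : MvPolynomial (Fin 3) ℂ) = 1 := by rw [← e4, ← C_mul]; norm_num
    simp only [smul_eq_C_mul, e2, e4, e5]
    linear_combination -(X 0 * X 1 * X 2 ^ 4) * e'

end Witness

theorem theorem2p8 :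
    ∃ U : Set (FormTuple 3 2 4), IsZariskiOpen U ∧ U.Nonempty ∧
      ∀ f ∈ U, ∀ k : ℕ, 1 ≤ k →
        hilbertSeries
            (Ideal.span (Set.range fun j => (f j : MvPolynomial (Fin 3) ℂ)) ^ k) =
          (∑ i ∈ Finset.range (2 * k),
              PowerSeries.C (((i + 2).choose 2 : ℕ) : ℤ) * PowerSeries.X ^ i) +
            PowerSeries.C (3 * (k : ℤ) - 1) * PowerSeries.X ^ (2 * k) := by
  obtain ⟨P₂, h₂, H₂⟩ := exists_eval_ne_zero_of_le_specializations witness_two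
  obtain ⟨P₃, h₃, H₃⟩ := exists_eval_ne_zero_of_le_specializations witness_three
  obtain ⟨P₄, h₄, H₄⟩ := exists_eval_ne_zero_of_le_specializations witness_four
  obtain ⟨Q₄, g₄, G₄⟩ := exists_eval_ne_zero_of_le_specializations witness_four'
  obtain ⟨P₆, h₆, H₆⟩ := exists_eval_ne_zero_of_le_specializations witness_six
  -- The five conditions share one witness and do not involve `k`, so a single principal open set
  -- serves every power.
  refine ⟨_, IsZariskiOpen.of_eval_ne_zero (P₂ * P₃ * P₄ * Q₄ * P₆), ⟨witnessQuadrics, ?_⟩,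
    fun f hf k hk => ?_⟩
  · simp only [Set.mem_ofPred_eq, map_mul]
    exact mul_ne_zero (mul_ne_zero (mul_ne_zero (mul_ne_zero h₂ h₃) h₄) g₄) h₆
  · simp only [Set.mem_ofPred_eq, map_mul, mul_ne_zero_iff] at hf
    obtain ⟨⟨⟨⟨f₂, f₃⟩, f₄⟩, f₄'⟩, f₆⟩ := hf
    have h : SpanConditions (f 0 : MvPolynomial (Fin 3) ℂ) (f 1) (f 2) (f 3) (X 0 * X 2)
        (X 0 * X 1) (X 0 * X 2 ^ 3) :=
      ⟨spanFour_le f, H₂ f f₂, H₃ f f₃, H₄ f f₄, G₄ f f₄', H₆ f f₆⟩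
    exact SpanConditions.hilbertSeries_pow (f := fun j => (f j : MvPolynomial (Fin 3) ℂ)) h
      ((isHomogeneous_X ℂ 0).mul (isHomogeneous_X ℂ 2))
      ((isHomogeneous_X ℂ 0).mul (isHomogeneous_X ℂ 1)) hk
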